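/- Theorem A. Let $p$ be a prime number, let $G$ be a $p$-adic analytic Lie group (a group that is also a finite-dimensional $p$-adic analytic manifold, with $p$-adic analytic product and inverse), and let $\mathfrak g=\mathrm T_{\mathbf 1}G$ be its Lie algebra. Let $M$ be a paracompact Hausdorff $p$-adic analytic manifold of dimension $2n$, and let $\omega$ be a $p$-adic analytic symplectic form on $M$, that is, a $p$-adic analytic $2$-form which is closed ($\mathrm d\omega=0$) and non-degenerate (for every $m\in M$ and $0\neq u\in\mathrm T_mM$ there is $v\in\mathrm T_mM$ with $\omega_m(u,v)\neq 0$). Let $\psi:G\times M\to M$ be a $p$-adic analytic symplectic action, that is, a $p$-adic analytic map with $\psi(\mathbf 1,m)=m$ and $\psi(g_1,\psi(g_2,m))=\psi(g_1g_2,m)$ for all $g_1,g_2\in G$, $m\in M$, and $\psi(g,\cdot)^*\omega=\omega$ for all $g\in G$. For $\xi\in\mathfrak g$ let $\mathrm X_\psi(\xi)$ be the vector field on $M$ generated by the action in the direction of $\xi$: $\mathrm X_\psi(\xi)(m)\in\mathrm T_mM$ is the image of $\xi$ under the tangent map at $\mathbf 1$ of $g\mapsto\psi(g,m)$. Then $\psi$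 is weakly Hamiltonian: there exists a $p$-adic analytic map $\mu:M\to\mathfrak g^*$ (a momentum map) such that, for every $\xi\in\mathfrak g$, $$\omega(\mathrm X_\psi(\xi),\cdot)=\mathrm d\mu_\xi,$$ where $\mu_\xi:M\to\mathbb Q_p$ is the function $\mu_\xi(m)=\langle\mu(m),\xi\rangle$. -/

import Mathlib

open scoped Manifold ContDiff

noncomputable section

namespace PadicSymplectic

/-! Smoothness of order `ω` means analyticity; symplectic forms are called `σ`. -/

/-- The model space `(ℚ_p)^d` of `d`-dimensional `p`-adic analytic manifolds. -/
abbrev Model (p : ℕ) [Fact p.Prime] (d : ℕ) : Type := Fin d → ℚ_[p]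

/-- The model with corners (without boundary) of `d`-dimensional `p`-adic analytic manifolds. -/
abbrev model (p : ℕ) [Fact p.Prime] (d : ℕ) :
    ModelWithCorners ℚ_[p] (Model p d) (Model p d) :=
  𝓘(ℚ_[p], Model p d)

/-- A differential `r`-form on a manifold modelled on `(ℚ_p)^d` (no regularity imposed): an
alternating `r`-linear form on each tangent space. -/
abbrev DiffForm (p : ℕ) [Fact p.Prime] (d r : ℕ) (M : Type*) [TopologicalSpace M]
    [ChartedSpace (Model p d) M] : Type _ :=
  ∀ m : M, TangentSpace (model p d) m [⋀^Fin r]→L[ℚ_[p]] ℚ_[p]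

section Forms

variable {p : ℕ} [Fact p.Prime] {d d' r : ℕ}
  {M : Type*} [TopologicalSpace M] [ChartedSpace (Model p d) M]
  {N : Type*} [TopologicalSpace N] [ChartedSpace (Model p d') N]

/-- The pullback `F^* α` of a differential form. -/
def DiffForm.pullback (F : M → N) (α : DiffForm p d' r N) : DiffForm p d r M := fun m =>
  (α (F m)).compContinuousLinearMap (mfderiv (model p d) (model p d') F m)

/-- The expression of a form `α` in a chart `e`: the form `(e⁻¹)^* α`, a function defined on
`(ℚ_p)^d`, which is meaningful on the open set `e.target`. -/
def DiffForm.inChart (α : DiffForm p d r M) (e : OpenPartialHomeomorph M (Model p d)) :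
    Model p d → Model p d [⋀^Fin r]→L[ℚ_[p]] ℚ_[p] :=
  DiffForm.pullback (e.symm : Model p d → M) α

/-- A form is `p`-adic analytic if its expression in every chart is locally given by convergent
power series. -/
def DiffForm.IsAnalytic (α : DiffForm p d r M) : Prop :=
  ∀ e ∈ atlas (Model p d) M, AnalyticOnNhd ℚ_[p] (α.inChart e) e.target

/-- `dα = 0`, where the exterior derivative is computed in charts. -/
def DiffForm.IsClosed (α : DiffForm p d r M) : Prop :=
  ∀ e ∈ atlas (Model p d) M, ∀ y ∈ e.target, extDeriv (α.inChart e) y = 0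

/-- A `p`-adic analytic symplectic form: an analytic, closed, non-degenerate `2`-form. -/
structure IsSymplecticForm (σ : DiffForm p d 2 M) : Prop where
  analytic : σ.IsAnalytic
  closed : σ.IsClosed
  nondegenerate : ∀ (m : M) (u : TangentSpace (model p d) m), u ≠ 0 →
    ∃ v : TangentSpace (model p d) m, σ m ![u, v] ≠ 0

end Forms

section Actions

variable {p : ℕ} [Fact p.Prime] {k d : ℕ}
  (G : Type*) [TopologicalSpace G] [ChartedSpace (Model p k) G] [Group G]
  {M : Type*} [TopologicalSpace M] [ChartedSpace (Model p d) M] [MulAction G M]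

/-- The action of `G` preserves the form `σ`: `(g • ·)^* σ = σ` for all `g`. -/
def IsSymplecticAction (σ : DiffForm p d 2 M) : Prop :=
  ∀ g : G, DiffForm.pullback (fun m : M => g • m) σ = σ

variable {G}

/-- The vector field on `M` generated by the action in the direction of `ξ ∈ 𝔤 = T_1 G`: at `m`, it
is the image of `ξ` under the tangent map at `1` of `g ↦ g • m`. It is a tangent vector at
`1 • m = m`. -/
def generator (ξ : GroupLieAlgebra (model p k) G) (m : M) : TangentSpace (model p d) m :=
  mfderiv (model p k) (model p d) (fun g : G => g • m) (1 : G) ξ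

/-- The dual `𝔤^*` of the Lie algebra `𝔤 = T_1 G` of a Lie group of dimension `k`. Here `𝔤`, which is
by definition the vector space `(ℚ_p)^k` (through the preferred chart at `1`), is given its norm, so
that `𝔤^*` is a finite-dimensional normed space and analyticity of maps into it makes sense. -/
abbrev LieDual (p : ℕ) [Fact p.Prime] (k : ℕ) : Type := StrongDual ℚ_[p] (Model p k)

/-- The natural pairing `⟨η, ξ⟩` between `𝔤^*` and `𝔤`. -/
def pairing (η : LieDual p k) (ξ : GroupLieAlgebra (model p k) G) : ℚ_[p] :=
  η ξ

variable (G) in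
/-- `μ : M → 𝔤^*` is a `p`-adic analytic momentum map: it is analytic, and
`σ(X(ξ), ·) = dμ_ξ` for all `ξ ∈ 𝔤`, where `μ_ξ(m) = ⟨μ(m), ξ⟩`. -/
structure IsMomentumMap (σ : DiffForm p d 2 M) (μ : M → LieDual p k) : Prop where
  analytic : ContMDiff (model p d) 𝓘(ℚ_[p], LieDual p k) ω μ
  hamilton : ∀ (ξ : GroupLieAlgebra (model p k) G) (m : M) (v : TangentSpace (model p d) m),
    σ m ![generator ξ m, v] =
      mfderiv (model p d) 𝓘(ℚ_[p], ℚ_[p]) (fun x : M => pairing (μ x) ξ) m v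

variable (k G) in
/-- The action of the `k`-dimensional Lie group `G` on `(M, σ)` is weakly Hamiltonian: it has an analytic momentum map. -/
def IsWeaklyHamiltonian (σ : DiffForm p d 2 M) : Prop :=
  ∃ μ : M → LieDual p k, IsMomentumMap G σ μ

end Actions

end PadicSymplectic

end

/-! For each ξ the 1-form σ(X(ξ), ·) is closed: since dσ = 0, Cartan's formula identifies its
differential with the Lie derivative of σ along X(ξ), which vanishes because the action preserves σ
(`fderiv_contraction_symm`). A closed p-adic analytic 1-form has an analytic primitive near every
point (`exists_primitive`). Taking 1-forms with values in the dual of 𝔤 treats all ξ at once and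
yields local momentum maps (`exists_local_momentumMap`).

There is no global obstruction: M is zero-dimensional, so the cover by domains of local solutions
refines to a partition into clopen sets (`exists_clopen_partition`). One local solution is chosen on
each piece, and the constants of integration never have to match.

In the Poincaré lemma, integrating along rays divides the degree n term by n. As |1/n| ≤ n, the
radius of convergence stays positive. This controls only the radial derivative; closedness forces
the rest. -/

namespace PadicSymplectic

section

open Filter Topology Set

/-! ### Poincaré lemma for p-adic power series. -/

section Poincare

variable {p : ℕ} [Fact p.Prime]
  {E : Type*} [NormedAddCommGroup E] [NormedSpace ℚ_[p] E]
  {F : Type*} [NormedAddCommGroup F] [NormedSpace ℚ_[p] F]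

/-- The left side is the largest power of p dividing n; for n = 0 both sides are 0. -/
theorem norm_natCast_inv_le (n : ℕ) : ‖((n : ℚ_[p])⁻¹)‖ ≤ n := by
  rcases eq_or_ne n 0 with rfl | hn
  · simp
  have hn' : (n : ℚ_[p]) ≠ 0 := by exact_mod_cast hn
  rw [norm_inv, Padic.norm_eq_zpow_neg_valuation hn', zpow_neg, inv_inv, Padic.valuation_natCast,
    zpow_natCast]
  exact_mod_cast Nat.le_of_dvd (Nat.pos_of_ne_zero hn) pow_padicValNat_dvd

/-- Termwise integration of a power series of `1`-forms along rays. -/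
noncomputable def radialPrimitiveSeries (P : FormalMultilinearSeries ℚ_[p] E (E →L[ℚ_[p]] F)) :
    FormalMultilinearSeries ℚ_[p] E F :=
  fun n => ((n : ℚ_[p])⁻¹) • P.unshift 0 n

theorem radius_radialPrimitiveSeries_pos (P : FormalMultilinearSeries ℚ_[p] E (E →L[ℚ_[p]] F))
    (hP : 0 < P.radius) : 0 < (radialPrimitiveSeries P).radius := by
  obtain ⟨C, r, hC, hr, h⟩ := (P.unshift 0).le_mul_pow_of_radius_pos
    (by rwa [FormalMultilinearSeries.radius_unshift])
  -- The factor 2 absorbs the denominators, through |1/n| ≤ n ≤ 2 ^ n.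
  have hr2 : 0 < (2 * r)⁻¹ := by positivity
  have hle : ((Real.toNNReal (2 * r)⁻¹ : NNReal) : ENNReal) ≤ (radialPrimitiveSeries P).radius := by
    refine FormalMultilinearSeries.le_radius_of_bound _ C fun n => ?_
    rw [Real.coe_toNNReal _ hr2.le]
    have h1 : ‖radialPrimitiveSeries P n‖ ≤ 2 ^ n * (C * r ^ n) := by
      refine (norm_smul_le _ _).trans (mul_le_mul ?_ (h n) (norm_nonneg _) (by positivity))
      exact (norm_natCast_inv_le n).trans (by exact_mod_cast Nat.lt_two_pow_self.le)
    calc ‖radialPrimitiveSeries P n‖ * (2 * r)⁻¹ ^ n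
        ≤ 2 ^ n * (C * r ^ n) * (2 * r)⁻¹ ^ n := by gcongr
      _ = C * (2 * r * (2 * r)⁻¹) ^ n := by rw [mul_pow, mul_pow]; ring
      _ = C := by rw [mul_inv_cancel₀ (by positivity), one_pow, mul_one]
  exact lt_of_lt_of_le (by simpa using hr) hle

/-- Euler's identity: differentiation along z - x multiplies the degree n term by n, which cancels
the 1/n of `radialPrimitiveSeries`. Closedness of A plays no role yet. -/
theorem exists_radial_primitive [CompleteSpace F] {A : E → E →L[ℚ_[p]] F} {x : E}
    (hA : AnalyticAt ℚ_[p] A x) :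
    ∃ f : E → F, AnalyticAt ℚ_[p] f x ∧
      ∀ᶠ z in 𝓝 x, fderiv ℚ_[p] f z (z - x) = A z (z - x) := by
  obtain ⟨P, r, hP⟩ := hA
  set q := radialPrimitiveSeries P with hq
  have hqpos : 0 < q.radius := radius_radialPrimitiveSeries_pos P hP.radius_pos
  have hf : HasFPowerSeriesOnBall (fun z => q.sum (z - x)) q x q.radius := by
    simpa using (q.hasFPowerSeriesOnBall hqpos).comp_sub x
  refine ⟨fun z => q.sum (z - x), hf.analyticAt, ?_⟩
  filter_upwards [Metric.eball_mem_nhds x hqpos, Metric.eball_mem_nhds x hP.r_pos] with z hz hz'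
  have h1 := (hf.fderiv.hasSum_sub hz).mapL (ContinuousLinearMap.apply ℚ_[p] F (z - x))
  have h2 := (hP.hasSum_sub hz').mapL (ContinuousLinearMap.apply ℚ_[p] F (z - x))
  refine h1.unique (h2.congr_fun ?_)
  intro n
  simp only [ContinuousLinearMap.apply_apply]
  rw [FormalMultilinearSeries.derivSeries_apply_diag]
  simp only [hq, radialPrimitiveSeries, FormalMultilinearSeries.unshift,
    smul_apply]
  rw [← Nat.cast_smul_eq_nsmul ℚ_[p], smul_smul, mul_inv_cancel₀ (by exact_mod_cast n.succ_ne_zero),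
    one_smul]
  simp
  rfl

/-- Differentiating B z (z - x) = 0 and using the symmetry of the derivative gives (Euler operator +
1) B = 0. This operator multiplies the degree n term by n + 1, which is nonzero in characteristic 0,
so every term of B vanishes. -/
theorem eventually_eq_zero_of_radial [CompleteSpace F] {B : E → E →L[ℚ_[p]] F} {x : E}
    (hB : AnalyticAt ℚ_[p] B x)
    (hsymm : ∀ᶠ z in 𝓝 x, ∀ u v, fderiv ℚ_[p] B z u v = fderiv ℚ_[p] B z v u)
    (hrad : ∀ᶠ z in 𝓝 x, B z (z - x) = 0) : ∀ᶠ z in 𝓝 x, B z = 0 := by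
  have hdiff : ∀ᶠ z in 𝓝 x, fderiv ℚ_[p] B z (z - x) + B z = 0 := by
    filter_upwards [hsymm, hrad.eventually_nhds, hB.eventually_analyticAt] with z hs hr ha
    ext v
    have h1 : HasFDerivAt (fun z => B z (z - x)) _ z :=
      ha.differentiableAt.hasFDerivAt.clm_apply ((hasFDerivAt_id z).sub_const x)
    have h2 : HasFDerivAt (fun z => B z (z - x)) (0 : E →L[ℚ_[p]] F) z :=
      (hasFDerivAt_const (0 : F) z).congr_of_eventuallyEq hr
    have h3 := congrArg (fun L : E →L[ℚ_[p]] F => L v) (h1.unique h2)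
    rw [add_apply, hs (z - x) v, add_comm]
    simpa using h3
  obtain ⟨b, r, hb⟩ := hB
  let c : FormalMultilinearSeries ℚ_[p] E (E →L[ℚ_[p]] F) := fun n => ((n + 1 : ℕ) : ℚ_[p]) • b n
  have hc : HasFPowerSeriesOnBall (fun z => fderiv ℚ_[p] B z (z - x) + B z) c x r := by
    refine ⟨hb.r_le.trans ?_, hb.r_pos, fun {y} hy => ?_⟩
    · refine FormalMultilinearSeries.radius_le_of_le fun n => ?_
      change ‖((n + 1 : ℕ) : ℚ_[p]) • b n‖ ≤ _
      rw [norm_smul]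
      -- Integers have p-adic norm at most 1, so these factors do not shrink the radius.
      exact mul_le_of_le_one_left (norm_nonneg _) (IsUltrametricDist.norm_natCast_le_one _ _)
    · have h1 := (hb.fderiv.hasSum hy).mapL (ContinuousLinearMap.apply ℚ_[p] _ y)
      have h2 := hb.hasSum hy
      simp only [ContinuousLinearMap.apply_apply,
        FormalMultilinearSeries.derivSeries_apply_diag] at h1
      have h3 : HasSum (fun n : ℕ => n • b n (fun _ => y)) (fderiv ℚ_[p] B (x + y) y) := by
        -- The derivative series starts in degree 1; the added degree 0 term is 0 • b 0 = 0.
        rw [← hasSum_nat_add_iff' 1]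
        simpa using h1
      have h4 := h3.add h2
      simp only [add_sub_cancel_left]
      refine h4.congr_fun fun n => ?_
      change ((n + 1 : ℕ) : ℚ_[p]) • b n (fun _ => y) = _
      rw [Nat.cast_smul_eq_nsmul, add_smul, one_smul]
  have hc0 : HasFPowerSeriesAt (0 : E → E →L[ℚ_[p]] F) c x :=
    HasFPowerSeriesAt.congr ⟨r, hc⟩ hdiff
  filter_upwards [Metric.eball_mem_nhds x hb.r_pos] with z hz
  refine (hb.hasSum_sub hz).unique ?_
  have h0 : ∀ n, b n (fun _ => z - x) = 0 := fun n => by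
    have := hc0.apply_eq_zero n (z - x)
    simp only [c, smul_apply, smul_eq_zero] at this
    exact this.resolve_left (by exact_mod_cast n.succ_ne_zero)
  simp [h0]

/-- The Poincaré lemma for closed `p`-adic analytic `1`-forms. -/
theorem exists_primitive [CompleteSpace F] {A : E → E →L[ℚ_[p]] F} {x : E}
    (hA : AnalyticAt ℚ_[p] A x)
    (hsymm : ∀ᶠ z in 𝓝 x, ∀ u v, fderiv ℚ_[p] A z u v = fderiv ℚ_[p] A z v u) :
    ∃ f : E → F, AnalyticAt ℚ_[p] f x ∧ ∀ᶠ z in 𝓝 x, HasFDerivAt f (A z) z := by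
  obtain ⟨f, hf, hrad⟩ := exists_radial_primitive hA
  refine ⟨f, hf, ?_⟩
  -- The error df - A is closed and vanishes radially, hence vanishes near x.
  have h := eventually_eq_zero_of_radial (hf.fderiv.sub hA) ?_ ?_
  · filter_upwards [h, hf.eventually_analyticAt] with z hz hfz
    rw [← sub_eq_zero.mp hz]
    exact hfz.differentiableAt.hasFDerivAt
  · filter_upwards [hsymm, hf.eventually_analyticAt, hA.eventually_analyticAt] with z hs hfz hAz u v
    have h2 : IsSymmSndFDerivAt ℚ_[p] f z :=
      hfz.contDiffAt.isSymmSndFDerivAt (n := ω) (by simp [minSmoothness])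
    rw [fderiv_sub hfz.fderiv.differentiableAt hAz.differentiableAt]
    simp [hs u v, h2 u v]
  · filter_upwards [hrad] with z hz
    simp [hz]

end Poincare

/-! ### Clopen partitions subordinate to a cover. -/

section Clopen

/-- Open covers of paracompact, locally compact, zero-dimensional Hausdorff spaces can be
refined to partitions into clopen sets. -/
theorem exists_clopen_partition {X : Type*} [TopologicalSpace X] [T2Space X] [ParacompactSpace X]
    [LocallyCompactSpace X] (hX : ∀ x : X, ∀ U ∈ 𝓝 x, ∃ D, IsClopen D ∧ x ∈ D ∧ D ⊆ U)
    (U : X → Set X) (hU : ∀ x, U x ∈ 𝓝 x) :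
    ∃ c : X → X, IsLocallyConstant c ∧ ∀ x, x ∈ U (c x) := by
  have hK : ∀ x, ∃ K : Set X, IsCompact K ∧ x ∈ interior K ∧ K ⊆ U x := fun x => by
    obtain ⟨K, hK, hKU, hc⟩ := local_compact_nhds (hU x)
    exact ⟨K, hc, mem_interior_iff_mem_nhds.2 hK, hKU⟩
  choose K hKc hKi hKU using hK
  obtain ⟨V, hVo, hVc, hVf, hVK⟩ := precise_refinement (fun x => interior (K x))
    (fun x => isOpen_interior) (iUnion_eq_univ_iff.2 fun x => ⟨x, hKi x⟩)
  obtain ⟨W, hWu, hWc, hWV⟩ := exists_iUnion_eq_closed_subset hVo (fun x => hVf.point_finite x) hVc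
  -- W i is closed in the compact K i, so finitely many clopen sets inside V i cover it.
  have hC : ∀ i, ∃ C : Set X, IsClopen C ∧ W i ⊆ C ∧ C ⊆ V i := fun i => by
    have hcomp : IsCompact (W i) :=
      (hKc i).of_isClosed_subset (hWc i) ((hWV i).trans ((hVK i).trans interior_subset))
    have hex : ∀ x ∈ W i, ∃ D : Set X, IsClopen D ∧ x ∈ D ∧ D ⊆ V i :=
      fun x hx => hX x _ ((hVo i).mem_nhds (hWV i hx))
    choose! D hD hxD hDV using hex
    obtain ⟨t, htW, ht⟩ := hcomp.elim_nhds_subcover D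
      (fun x hx => (hD x hx).isOpen.mem_nhds (hxD x hx))
    refine ⟨⋃ x ∈ t, D x, t.finite_toSet.isClopen_biUnion fun x hx => hD x (htW x hx), ht, ?_⟩
    exact iUnion₂_subset fun x hx => hDV x (htW x hx)
  choose C hC hWC hCV using hC
  have hCf : LocallyFinite C := hVf.subset hCV
  have hcov : ∀ x, ∃ i, x ∈ C i := fun x => by
    obtain ⟨i, hi⟩ := mem_iUnion.1 (hWu.symm ▸ mem_univ x : x ∈ ⋃ i, W i)
    exact ⟨i, hWC i hi⟩
  -- The chosen index depends only on the set of i with x ∈ C i, and this set is locally constant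
  -- since the C i are clopen and locally finite. No disjointification is needed.
  refine ⟨fun x => @Classical.epsilon X ⟨x⟩ fun i => x ∈ C i, ?_, fun x => ?_⟩
  · rw [IsLocallyConstant.iff_eventually_eq]
    intro x
    obtain ⟨N, hN, hfin⟩ := hCf x
    have hev : ∀ᶠ y in 𝓝 x, ∀ i ∈ {i | (C i ∩ N).Nonempty}, (y ∈ C i ↔ x ∈ C i) := by
      rw [eventually_all_finite hfin]
      intro i _
      by_cases hx : x ∈ C i
      · filter_upwards [(hC i).isOpen.mem_nhds hx] with y hy using iff_of_true hy hx
      · filter_upwards [(hC i).compl.isOpen.mem_nhds hx] with y hy using iff_of_false hy hx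
    filter_upwards [hev, hN] with y hy hyN
    have : (fun i => y ∈ C i) = fun i => x ∈ C i := by
      ext i
      by_cases hi : (C i ∩ N).Nonempty
      · exact hy i hi
      · exact iff_of_false (fun h => hi ⟨y, h, hyN⟩) fun h => hi ⟨x, h, mem_of_mem_nhds hN⟩
    simp only [this]
  · have h := @Classical.epsilon_spec_aux X ⟨x⟩ (fun i => x ∈ C i) (hcov x)
    exact hKU _ (interior_subset (hVK _ (hCV _ h)))

/-- Closed balls of (ℚ_p)^d are open and compact; their images under an inverse chart are open, and
closed because M is Hausdorff. -/
theorem exists_isClopen_subset (p : ℕ) [Fact p.Prime] (d : ℕ) {M : Type*} [TopologicalSpace M]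
    [T2Space M] [ChartedSpace (Model p d) M] (x : M) (U : Set M) (hU : U ∈ 𝓝 x) :
    ∃ D, IsClopen D ∧ x ∈ D ∧ D ⊆ U := by
  set e := chartAt (Model p d) x
  have hx : x ∈ e.source := mem_chart_source _ x
  have hpre : e.target ∩ e.symm ⁻¹' interior U ∈ 𝓝 (e x) :=
    (e.isOpen_inter_preimage_symm isOpen_interior).mem_nhds
      ⟨e.map_source hx, by simpa [e.left_inv hx] using mem_interior_iff_mem_nhds.2 hU⟩
  obtain ⟨r, hr, hsub⟩ := Metric.nhds_basis_closedBall.mem_iff.1 hpre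
  have hopen : IsOpen (Metric.closedBall (e x) r) := IsUltrametricDist.isOpen_closedBall _ hr.ne'
  have htgt : Metric.closedBall (e x) r ⊆ e.target := hsub.trans inter_subset_left
  refine ⟨e.symm '' Metric.closedBall (e x) r, ⟨?_, ?_⟩, ?_, ?_⟩
  · exact ((isCompact_closedBall _ _).image_of_continuousOn
      (e.continuousOn_symm.mono htgt)).isClosed
  · exact e.symm.isOpen_image_of_subset_source hopen htgt
  · exact ⟨e x, Metric.mem_closedBall_self hr.le, e.left_inv hx⟩
  · rintro _ ⟨y, hy, rfl⟩
    exact interior_subset (hsub hy).2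

end Clopen

/-! ### Cartan's formula in coordinates. -/

section LocalClosedness

variable {𝕜 : Type*} [NontriviallyNormedField 𝕜]
  {E : Type*} [NormedAddCommGroup E] [NormedSpace 𝕜 E]
  {V : Type*} [NormedAddCommGroup V] [NormedSpace 𝕜 V]

variable (𝕜 E) in
/-- Alternating `2`-forms as bilinear maps. -/
noncomputable def alternatingToBilin :=
  (ContinuousLinearMap.compL 𝕜 E (E [⋀^Fin 1]→L[𝕜] 𝕜) (E →L[𝕜] 𝕜)
    (ContinuousAlternatingMap.ofSubsingletonLIE (𝕜 := 𝕜) (E := E) (F := 𝕜)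
      (0 : Fin 1)).symm.toLinearIsometry.toContinuousLinearMap).comp
  (ContinuousAlternatingMap.curryLeftLI (𝕜 := 𝕜) (E := E) (F := 𝕜)
    (n := 1)).toContinuousLinearMap

@[simp]
theorem alternatingToBilin_apply (α : E [⋀^Fin 2]→L[𝕜] 𝕜) (u v : E) :
    alternatingToBilin 𝕜 E α u v = α ![u, v] := by
  change α (Matrix.vecCons u fun _ => v) = _
  congr 1
  ext i
  fin_cases i <;> rfl

theorem analyticAt_alternatingToBilin (α : E [⋀^Fin 2]→L[𝕜] 𝕜) :
    AnalyticAt 𝕜 (alternatingToBilin 𝕜 E) α := by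
  apply ContinuousLinearMap.analyticAt

theorem alternatingToBilin_swap (α : E [⋀^Fin 2]→L[𝕜] 𝕜) (u v : E) :
    alternatingToBilin 𝕜 E α u v = -alternatingToBilin 𝕜 E α v u := by
  rw [alternatingToBilin_apply, alternatingToBilin_apply]
  have := α.toAlternatingMap.map_swap ![v, u] (i := 0) (j := 1) (by decide)
  have h : (![v, u] ∘ ⇑(Equiv.swap 0 1) : Fin 2 → E) = ![u, v] := by
    ext i
    fin_cases i <;> simp
  rw [h] at this
  exact this

theorem fderiv_alternatingToBilin_of_extDeriv_eq_zero {S : E → E [⋀^Fin 2]→L[𝕜] 𝕜} {y : E}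
    (hS : AnalyticAt 𝕜 S y) (hd : extDeriv S y = 0) (a b c : E) :
    fderiv 𝕜 (fun z => alternatingToBilin 𝕜 E (S z)) y a b c =
      fderiv 𝕜 (fun z => alternatingToBilin 𝕜 E (S z)) y b a c
        - fderiv 𝕜 (fun z => alternatingToBilin 𝕜 E (S z)) y c a b := by
  have hT : HasFDerivAt (fun z => alternatingToBilin 𝕜 E (S z)) _ y :=
    ((analyticAt_alternatingToBilin (S y)).fun_comp hS).differentiableAt.hasFDerivAt
  have happly : ∀ a b c, fderiv 𝕜 (fun z => S z ![b, c]) y a =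
      fderiv 𝕜 (fun z => alternatingToBilin 𝕜 E (S z)) y a b c := fun a b c => by
    have h1 : HasFDerivAt (fun z => alternatingToBilin 𝕜 E (S z) b c) _ y :=
      (hT.clm_apply (hasFDerivAt_const b y)).clm_apply (hasFDerivAt_const c y)
    simp only [alternatingToBilin_apply] at h1
    rw [h1.fderiv]
    simp
  have h := extDeriv_apply hS.differentiableAt ![a, b, c]
  have e0 : (0 : Fin 3).removeNth ![a, b, c] = ![b, c] := by
    ext i
    fin_cases i <;> rfl
  have e1 : (1 : Fin 3).removeNth ![a, b, c] = ![a, c] := by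
    ext i
    fin_cases i <;> rfl
  have e2 : (2 : Fin 3).removeNth ![a, b, c] = ![a, b] := by
    ext i
    fin_cases i <;> rfl
  rw [Fin.sum_univ_three, hd, e0, e1, e2, happly, happly, happly] at h
  simp at h
  linear_combination -h

theorem analyticAt_flip {F : Type*} [NormedAddCommGroup F] [NormedSpace 𝕜 F]
    (L : V →L[𝕜] E →L[𝕜] F) : AnalyticAt 𝕜 (fun L : V →L[𝕜] E →L[𝕜] F => L.flip) L := by
  change AnalyticAt 𝕜
    (ContinuousLinearMap.flipₗᵢ 𝕜 V E F).toContinuousLinearEquiv.toContinuousLinearMap L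
  apply ContinuousLinearMap.analyticAt

theorem analyticAt_comp {F : Type*} [NormedAddCommGroup F] [NormedSpace 𝕜 F]
    (q : (E →L[𝕜] F) × (V →L[𝕜] E)) :
    AnalyticAt 𝕜 (fun q : (E →L[𝕜] F) × (V →L[𝕜] E) => q.1 ∘L q.2) q :=
  (ContinuousLinearMap.compL 𝕜 V E F).analyticAt_bilinear q

/-- The contraction of a `2`-form `T` with the vector fields generated by the family of maps
`Ψ (s, ·)` at the parameter `s₀`, as a `1`-form with values in the dual of the parameter space. -/
noncomputable def contraction (T : E → E →L[𝕜] E →L[𝕜] 𝕜) (Ψ : V × E → E) (s₀ : V) (y : E) :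
    E →L[𝕜] V →L[𝕜] 𝕜 :=
  (T y ∘L (fderiv 𝕜 Ψ (s₀, y) ∘L ContinuousLinearMap.inl 𝕜 V E)).flip

@[simp]
theorem contraction_apply (T : E → E →L[𝕜] E →L[𝕜] 𝕜) (Ψ : V × E → E) (s₀ : V) (y v : E) (ξ : V) :
    contraction T Ψ s₀ y v ξ = T y (fderiv 𝕜 Ψ (s₀, y) (ξ, 0)) v := rfl

theorem analyticAt_contraction [CompleteSpace E] {T : E → E →L[𝕜] E →L[𝕜] 𝕜} {Ψ : V × E → E}
    {s₀ : V} {y : E} (hT : AnalyticAt 𝕜 T y) (hΨ : AnalyticAt 𝕜 Ψ (s₀, y)) :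
    AnalyticAt 𝕜 (contraction T Ψ s₀) y := by
  have h1 : AnalyticAt 𝕜 (fun y => fderiv 𝕜 Ψ (s₀, y)) y :=
    AnalyticAt.fun_comp (f := fun y : E => (s₀, y)) hΨ.fderiv (analyticAt_const.prod analyticAt_id)
  have h2 : AnalyticAt 𝕜 (fun y => fderiv 𝕜 Ψ (s₀, y) ∘L ContinuousLinearMap.inl 𝕜 V E) y :=
    ((ContinuousLinearMap.compL 𝕜 V (V × E) E).flip
      (ContinuousLinearMap.inl 𝕜 V E)).analyticAt _ |>.fun_comp h1
  exact (analyticAt_flip _).fun_comp ((analyticAt_comp (T y, _)).comp₂ hT h2)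

/-- Cartan's formula without flows: only the first-order variation of the invariance at s₀, where Ψ
is the identity, is needed. Write X(y) for the derivative of Ψ at (s₀, y) along (ξ, 0). -/
theorem fderiv_contraction_symm [CompleteSpace E] {T : E → E →L[𝕜] E →L[𝕜] 𝕜} {Ψ : V × E → E}
    {s₀ : V} {y : E} (hT : AnalyticAt 𝕜 T y) (hΨ : AnalyticAt 𝕜 Ψ (s₀, y))
    (hid : ∀ᶠ z in 𝓝 y, Ψ (s₀, z) = z)
    (hswap : ∀ u v, T y u v = -T y v u)
    (hclosed : ∀ a b c, fderiv 𝕜 T y a b c = fderiv 𝕜 T y b a c - fderiv 𝕜 T y c a b)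
    (hinv : ∀ᶠ z in 𝓝 (s₀, y), ∀ u v,
      T (Ψ z) (fderiv 𝕜 Ψ z (0, u)) (fderiv 𝕜 Ψ z (0, v)) = T z.2 u v) (u v : E) :
    fderiv 𝕜 (contraction T Ψ s₀) y u v = fderiv 𝕜 (contraction T Ψ s₀) y v u := by
  have hA := (analyticAt_contraction hT hΨ).differentiableAt
  have hDD := hΨ.fderiv.differentiableAt.hasFDerivAt
  have hD := hΨ.differentiableAt.hasFDerivAt
  have hTD := hT.differentiableAt.hasFDerivAt
  have hy : Ψ (s₀, y) = y := hid.self_of_nhds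
  have hsymm : IsSymmSndFDerivAt 𝕜 Ψ (s₀, y) :=
    hΨ.contDiffAt.isSymmSndFDerivAt (n := ω) (by simp [minSmoothness])
  have hDid : ∀ w, fderiv 𝕜 Ψ (s₀, y) (0, w) = w := fun w => by
    have h1 : HasFDerivAt (fun z : E => Ψ (s₀, z)) _ y :=
      HasFDerivAt.comp (f := fun z : E => (s₀, z)) y hD (hasFDerivAt_prodMk_right s₀ y)
    have h2 := (hasFDerivAt_id (𝕜 := 𝕜) y).congr_of_eventuallyEq hid
    simpa using congrArg (fun L : E →L[𝕜] E => L w) (h1.unique h2)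
  ext ξ
  -- Product rule for T(X, v) in the direction u.
  have key : ∀ u v, fderiv 𝕜 (contraction T Ψ s₀) y u v ξ =
      fderiv 𝕜 T y u (fderiv 𝕜 Ψ (s₀, y) (ξ, 0)) v
        + T y (fderiv 𝕜 (fderiv 𝕜 Ψ) (s₀, y) (0, u) (ξ, 0)) v := fun u v => by
    have h1 : HasFDerivAt (fun z => contraction T Ψ s₀ z v ξ) _ y :=
      (hA.hasFDerivAt.clm_apply (hasFDerivAt_const v y)).clm_apply (hasFDerivAt_const ξ y)
    have h2 : HasFDerivAt (fun z : E => fderiv 𝕜 Ψ (s₀, z)) _ y :=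
      HasFDerivAt.comp (f := fun z : E => (s₀, z)) y hDD (hasFDerivAt_prodMk_right s₀ y)
    have h3 : HasFDerivAt (fun z => T z (fderiv 𝕜 Ψ (s₀, z) (ξ, 0)) v) _ y :=
      (hTD.clm_apply (h2.clm_apply (hasFDerivAt_const (ξ, (0 : E)) y))).clm_apply
        (hasFDerivAt_const v y)
    have h4 := congrArg (fun L : E →L[𝕜] 𝕜 => L u) (h1.unique h3)
    simpa [add_comm] using h4
  -- The Lie derivative of T along X is 0: the invariance is differentiated along (ξ, 0), where its
  -- right-hand side is constant.
  have hinv' : fderiv 𝕜 T y (fderiv 𝕜 Ψ (s₀, y) (ξ, 0)) u v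
      + T y (fderiv 𝕜 (fderiv 𝕜 Ψ) (s₀, y) (ξ, 0) (0, u)) v
      + T y u (fderiv 𝕜 (fderiv 𝕜 Ψ) (s₀, y) (ξ, 0) (0, v)) = 0 := by
    have hTΨ : HasFDerivAt (fun z => T (Ψ z)) (fderiv 𝕜 T y ∘L fderiv 𝕜 Ψ (s₀, y)) (s₀, y) :=
      HasFDerivAt.comp (g := T) (s₀, y) (by rwa [hy]) hD
    have h1 := (hTΨ.clm_apply (hDD.clm_apply (hasFDerivAt_const ((0 : V), u) (s₀, y)))).clm_apply
      (hDD.clm_apply (hasFDerivAt_const ((0 : V), v) (s₀, y)))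
    have h2 : HasFDerivAt (fun z : V × E => T z.2 u v) _ (s₀, y) :=
      ((HasFDerivAt.comp (s₀, y) (f := Prod.snd) hTD hasFDerivAt_snd).clm_apply
        (hasFDerivAt_const u (s₀, y))).clm_apply (hasFDerivAt_const v (s₀, y))
    have h3 := h2.congr_of_eventuallyEq (hinv.mono fun z hz => hz u v)
    have h4 := congrArg (fun L : V × E →L[𝕜] 𝕜 => L (ξ, 0)) (h1.unique h3)
    simp [hDid, hy] at h4
    rw [← h4]
    ring
  -- Exchanging the mixed second derivatives of Ψ makes both formulas comparable with `hinv'`.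
  rw [key, key, ← hsymm.eq, ← hsymm.eq (ξ, 0)]
  have h5 := hclosed (fderiv 𝕜 Ψ (s₀, y) (ξ, 0)) u v
  have h6 := hswap u (fderiv 𝕜 (fderiv 𝕜 Ψ) (s₀, y) (ξ, 0) (0, v))
  linear_combination hinv' - h5 - h6

end LocalClosedness

/-! ### The action read in charts. -/

section LocalAction

variable {p : ℕ} [Fact p.Prime] {k d : ℕ}
  {G : Type*} [TopologicalSpace G] [Group G]
  {M : Type*} [TopologicalSpace M] [MulAction G M]

/-- The expression of the action in charts of the group and of the manifold. -/
noncomputable def localAction (c : OpenPartialHomeomorph G (Model p k)) (e : OpenPartialHomeomorph M (Model p d))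
    (z : Model p k × Model p d) : Model p d :=
  e (c.symm z.1 • e.symm z.2)

/-- The set on which `localAction c e` is meaningful. -/
def localActionDomain (c : OpenPartialHomeomorph G (Model p k))
    (e : OpenPartialHomeomorph M (Model p d)) : Set (Model p k × Model p d) :=
  {z | z.1 ∈ c.target ∧ z.2 ∈ e.target ∧ c.symm z.1 • e.symm z.2 ∈ e.source}

variable {c : OpenPartialHomeomorph G (Model p k)} {e : OpenPartialHomeomorph M (Model p d)}
  {z : Model p k × Model p d}

theorem one_mem_localActionDomain (hc : (1 : G) ∈ c.source) {y : Model p d} (hy : y ∈ e.target) :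
    (c 1, y) ∈ localActionDomain c e := by
  refine ⟨c.map_source hc, hy, ?_⟩
  simpa [c.left_inv hc] using e.map_target hy

theorem localAction_one (hc : (1 : G) ∈ c.source) {y : Model p d} (hy : y ∈ e.target) :
    localAction c e (c 1, y) = y := by
  simp [localAction, c.left_inv hc, e.right_inv hy]

theorem symm_localAction (hz : z ∈ localActionDomain c e) :
    e.symm (localAction c e z) = c.symm z.1 • e.symm z.2 :=
  e.left_inv hz.2.2

theorem localAction_mem_target (hz : z ∈ localActionDomain c e) : localAction c e z ∈ e.target :=
  e.map_source hz.2.2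

theorem eventually_mem_localActionDomain [ContinuousSMul G M] (hz : z ∈ localActionDomain c e) :
    ∀ᶠ w in 𝓝 z, w ∈ localActionDomain c e := by
  have h1 : ContinuousAt (fun w : Model p k × Model p d => c.symm w.1 • e.symm w.2) z :=
    ((c.continuousAt_symm hz.1).comp continuousAt_fst).smul
      ((e.continuousAt_symm hz.2.1).comp continuousAt_snd)
  filter_upwards [continuousAt_fst (c.open_target.mem_nhds hz.1),
    continuousAt_snd (e.open_target.mem_nhds hz.2.1), h1 (e.open_source.mem_nhds hz.2.2)]
    with w h2 h3 h4 using ⟨h2, h3, h4⟩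

variable [ChartedSpace (Model p k) G] [ChartedSpace (Model p d) M]
  [IsManifold (model p k) ω G] [IsManifold (model p d) ω M]
  [ContMDiffSMul (model p k) (model p d) ω G M]

theorem analyticAt_localAction (hc : c ∈ atlas (Model p k) G) (he : e ∈ atlas (Model p d) M)
    (hz : z ∈ localActionDomain c e) : AnalyticAt ℚ_[p] (localAction c e) z := by
  have hc' := IsManifold.subset_maximalAtlas (I := model p k) (n := ω) hc
  have he' := IsManifold.subset_maximalAtlas (I := model p d) (n := ω) he
  have h1 : ContMDiffAt 𝓘(ℚ_[p], Model p k × Model p d) (model p k) ω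
      (fun w : Model p k × Model p d => c.symm w.1) z :=
    (contMDiffAt_symm_of_mem_maximalAtlas hc' hz.1).comp z contDiff_fst.contMDiff.contMDiffAt
  have h2 : ContMDiffAt 𝓘(ℚ_[p], Model p k × Model p d) (model p d) ω
      (fun w : Model p k × Model p d => e.symm w.2) z :=
    (contMDiffAt_symm_of_mem_maximalAtlas he' hz.2.1).comp z contDiff_snd.contMDiff.contMDiffAt
  have h3 : ContMDiffAt 𝓘(ℚ_[p], Model p k × Model p d) (model p d) ω (localAction c e) z :=
    (contMDiffAt_of_mem_maximalAtlas he' hz.2.2).comp z (h1.smul h2)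
  exact h3.contDiffAt.analyticAt

/-- Chain rule for the relation `symm_localAction`, with the group variable fixed. -/
theorem mfderiv_smul_symm (hc : c ∈ atlas (Model p k) G) (he : e ∈ atlas (Model p d) M)
    (hz : z ∈ localActionDomain c e) (u : Model p d) :
    (mfderiv (model p d) (model p d) (fun m : M => c.symm z.1 • m) (e.symm z.2)
      (mfderiv (model p d) (model p d) e.symm z.2 u) : Model p d) =
    mfderiv (model p d) (model p d) e.symm (localAction c e z)
      (fderiv ℚ_[p] (localAction c e) z (0, u)) := by
  have := ContMDiffSMul.continuousSMul (G := G) (M := M) (I := model p k) (I' := model p d) ω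
  have h1 : MDifferentiableAt (model p d) (model p d) (fun m : M => c.symm z.1 • m) (e.symm z.2) :=
    ((contMDiffAt_const (I' := model p k)).smul contMDiffAt_id).mdifferentiableAt (n := ω) (by simp)
  have h2 := mdifferentiableAt_atlas_symm (I := model p d) he hz.2.1
  have h3 := mdifferentiableAt_atlas_symm (I := model p d) he (localAction_mem_target hz)
  have h4 : HasFDerivAt (fun y => localAction c e (z.1, y))
      (fderiv ℚ_[p] (localAction c e) z ∘L ContinuousLinearMap.inr ℚ_[p] _ _) z.2 :=
    HasFDerivAt.comp (f := fun y => (z.1, y)) z.2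
      (analyticAt_localAction hc he hz).differentiableAt.hasFDerivAt (hasFDerivAt_prodMk_right z.1 z.2)
  have h5 : (fun m : M => c.symm z.1 • m) ∘ e.symm =ᶠ[𝓝 z.2]
      e.symm ∘ fun y => localAction c e (z.1, y) := by
    have : ContinuousAt (fun y : Model p d => (z.1, y)) z.2 := by fun_prop
    filter_upwards [this (eventually_mem_localActionDomain hz)] with y hy
    exact (symm_localAction hy).symm
  have h6 := h5.mfderiv_eq (I := model p d) (I' := model p d)
  rw [mfderiv_comp z.2 h1 h2, mfderiv_comp z.2 (by exact h3) h4.differentiableAt.mdifferentiableAt,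
    mfderiv_eq_fderiv, h4.fderiv] at h6
  exact congrArg (fun L : Model p d →L[ℚ_[p]] Model p d => L u) h6

theorem generator_eq {m : M} (he : e ∈ atlas (Model p d) M) (hm : m ∈ e.source)
    (ξ : GroupLieAlgebra (model p k) G) :
    (generator ξ m : Model p d) = mfderiv (model p d) (model p d) e.symm (e m)
      (fderiv ℚ_[p] (localAction (chartAt (Model p k) (1 : G)) e)
        (chartAt (Model p k) (1 : G) 1, e m) (ξ, 0)) := by
  set c := chartAt (Model p k) (1 : G)
  have := ContMDiffSMul.continuousSMul (G := G) (M := M) (I := model p k) (I' := model p d) ω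
  have hcs : (1 : G) ∈ c.source := mem_chart_source _ _
  have hca : c ∈ atlas (Model p k) G := chart_mem_atlas _ _
  have hz : (c 1, e m) ∈ localActionDomain c e := one_mem_localActionDomain hcs (e.map_source hm)
  have hΨ : localAction c e (c 1, e m) = e m := localAction_one hcs (e.map_source hm)
  have h1 : MDifferentiableAt (model p k) (model p d) (fun g : G => g • m) 1 :=
    (contMDiffAt_id.smul (contMDiffAt_const (I' := model p d))).mdifferentiableAt (n := ω) (by simp)
  have h2 := mdifferentiableAt_atlas_symm (I := model p k) hca (c.map_source hcs)
  have h3 := mdifferentiableAt_atlas_symm (I := model p d) he (e.map_source hm)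
  have h4 : HasFDerivAt (fun s => localAction c e (s, e m))
      (fderiv ℚ_[p] (localAction c e) (c 1, e m) ∘L ContinuousLinearMap.inl ℚ_[p] _ _) (c 1) :=
    HasFDerivAt.comp (f := fun s => (s, e m)) (c 1)
      (analyticAt_localAction hca he hz).differentiableAt.hasFDerivAt
      (hasFDerivAt_prodMk_left (c 1) (e m))
  have h5 : (fun g : G => g • m) ∘ c.symm =ᶠ[𝓝 (c 1)]
      e.symm ∘ fun s => localAction c e (s, e m) := by
    have : ContinuousAt (fun s : Model p k => (s, e m)) (c 1) := by fun_prop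
    filter_upwards [this (eventually_mem_localActionDomain hz)] with s hs
    simpa [e.left_inv hm] using (symm_localAction hs).symm
  -- The tangent space at 1 is read in the preferred chart c, whose derivative there is therefore
  -- the identity; this lets ξ serve as a coordinate vector.
  have hid : mfderiv (model p k) (model p k) c.symm (c 1) =
      ContinuousLinearMap.id ℚ_[p] (Model p k) := by
    have h6 := (mdifferentiable_chart (I := model p k) (1 : G)).symm_comp_deriv hcs
    have h7 : mfderiv (model p k) (model p k) c 1 = ContinuousLinearMap.id ℚ_[p] (Model p k) :=
      mfderiv_extChartAt_self (I := model p k) (x := (1 : G))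
    rw [h7] at h6
    exact h6
  have h6 := h5.mfderiv_eq (I := model p k) (I' := model p d)
  rw [mfderiv_comp_of_eq (y := 1) h1 h2 (c.left_inv hcs),
    mfderiv_comp_of_eq (y := e m) h3 h4.differentiableAt.mdifferentiableAt hΨ,
    mfderiv_eq_fderiv, h4.fderiv, hid, c.left_inv hcs, hΨ] at h6
  exact congrArg (fun L : Model p k →L[ℚ_[p]] Model p d => L ξ) h6

end LocalAction

/-! ### Local momentum maps. -/

section MomentumMap

variable {p : ℕ} [Fact p.Prime] {k d : ℕ}
  {M : Type*} [TopologicalSpace M] [ChartedSpace (Model p d) M]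

/-- All tangent spaces unfold to the model space, so the base point can change while the vectors
stay put. -/
theorem DiffForm.apply_congr {r : ℕ} (σ : DiffForm p d r M) {m m' : M} (h : m = m')
    (v : Fin r → Model p d) : σ m v = σ m' v := by
  subst h
  rfl

theorem DiffForm.pullback_apply_pair {N : Type*} [TopologicalSpace N] {d' : ℕ}
    [ChartedSpace (Model p d') N] (σ : DiffForm p d 2 M) (F : N → M) (x : N)
    (u v : TangentSpace (model p d') x) :
    DiffForm.pullback F σ x ![u, v] = σ (F x)
      ![mfderiv (model p d') (model p d) F x u, mfderiv (model p d') (model p d) F x v] := by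
  rw [DiffForm.pullback, ContinuousAlternatingMap.compContinuousLinearMap_apply]
  congr 1
  ext i
  fin_cases i <;> rfl

theorem DiffForm.inChart_apply_pair (σ : DiffForm p d 2 M)
    (e : OpenPartialHomeomorph M (Model p d)) (y u v : Model p d) :
    σ.inChart e y ![u, v] = σ (e.symm y) ![mfderiv (model p d) (model p d) e.symm y u,
      mfderiv (model p d) (model p d) e.symm y v] :=
  DiffForm.pullback_apply_pair σ e.symm y u v

variable {G : Type*} [TopologicalSpace G] [ChartedSpace (Model p k) G] [Group G] [MulAction G M]
  [IsManifold (model p k) ω G] [IsManifold (model p d) ω M]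
  [ContMDiffSMul (model p k) (model p d) ω G M]

/-- This supplies the invariance hypothesis of `fderiv_contraction_symm`. -/
theorem inChart_localAction {σ : DiffForm p d 2 M} (hG : IsSymplecticAction G σ)
    {c : OpenPartialHomeomorph G (Model p k)} {e : OpenPartialHomeomorph M (Model p d)}
    {z : Model p k × Model p d} (hc : c ∈ atlas (Model p k) G) (he : e ∈ atlas (Model p d) M)
    (hz : z ∈ localActionDomain c e) (u v : Model p d) :
    σ.inChart e (localAction c e z) ![fderiv ℚ_[p] (localAction c e) z (0, u),
      fderiv ℚ_[p] (localAction c e) z (0, v)] = σ.inChart e z.2 ![u, v] := by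
  rw [DiffForm.inChart_apply_pair, DiffForm.inChart_apply_pair]
  have hpb := DiffForm.pullback_apply_pair σ (fun m : M => c.symm z.1 • m) (e.symm z.2)
    (mfderiv (model p d) (model p d) e.symm z.2 u) (mfderiv (model p d) (model p d) e.symm z.2 v)
  rw [hG (c.symm z.1)] at hpb
  refine Eq.trans ?_ hpb.symm
  refine (DiffForm.apply_congr σ (symm_localAction hz) _).trans ?_
  refine congrArg (fun w : Fin 2 → Model p d => σ (c.symm z.1 • e.symm z.2) w) ?_
  exact congrArg₂ (fun a b : Model p d => ![a, b]) (mfderiv_smul_symm hc he hz u).symm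
    (mfderiv_smul_symm hc he hz v).symm

variable (G) in
-- The solution is a primitive of the contraction in a chart at x, pulled back to M. It must be
-- valid on a whole neighbourhood of x, which becomes a member of the cover to be refined.
theorem exists_local_momentumMap {σ : DiffForm p d 2 M} (hσ : IsSymplecticForm σ)
    (hG : IsSymplecticAction G σ) (x : M) :
    ∃ μ : M → LieDual p k, ∀ᶠ m in 𝓝 x,
      ContMDiffAt (model p d) 𝓘(ℚ_[p], LieDual p k) ω μ m ∧
      ∀ (ξ : GroupLieAlgebra (model p k) G) (v : TangentSpace (model p d) m),
        σ m ![generator ξ m, v] =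
          mfderiv (model p d) 𝓘(ℚ_[p], ℚ_[p]) (fun x : M => pairing (μ x) ξ) m v := by
  have := ContMDiffSMul.continuousSMul (G := G) (M := M) (I := model p k) (I' := model p d) ω
  set c := chartAt (Model p k) (1 : G)
  set e := chartAt (Model p d) x
  have hcs : (1 : G) ∈ c.source := mem_chart_source _ _
  have hca : c ∈ atlas (Model p k) G := chart_mem_atlas _ _
  have hea : e ∈ atlas (Model p d) M := chart_mem_atlas _ _
  have hx : x ∈ e.source := mem_chart_source _ _
  set T : Model p d → Model p d →L[ℚ_[p]] Model p d →L[ℚ_[p]] ℚ_[p] :=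
    fun y => alternatingToBilin ℚ_[p] (Model p d) (σ.inChart e y) with hT
  have hTa : ∀ y ∈ e.target, AnalyticAt ℚ_[p] T y := fun y hy =>
    (analyticAt_alternatingToBilin (σ.inChart e y)).fun_comp (hσ.analytic e hea y hy)
  have hΨa : ∀ y ∈ e.target, AnalyticAt ℚ_[p] (localAction c e) (c 1, y) := fun y hy =>
    analyticAt_localAction hca hea (one_mem_localActionDomain hcs hy)
  have hsymm : ∀ y ∈ e.target, ∀ u v,
      fderiv ℚ_[p] (contraction T (localAction c e) (c 1)) y u v =
        fderiv ℚ_[p] (contraction T (localAction c e) (c 1)) y v u := fun y hy => by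
    refine fderiv_contraction_symm (hTa y hy) (hΨa y hy) ?_ (alternatingToBilin_swap _) ?_ ?_
    · filter_upwards [e.open_target.mem_nhds hy] with w hw using localAction_one hcs hw
    · exact fderiv_alternatingToBilin_of_extDeriv_eq_zero (hσ.analytic e hea y hy)
        (hσ.closed e hea y hy)
    · filter_upwards [eventually_mem_localActionDomain (one_mem_localActionDomain hcs hy)]
        with z hz u v
      simpa [hT] using inChart_localAction hG hca hea hz u v
  have hxt : e x ∈ e.target := e.map_source hx
  obtain ⟨f, hf, hfA⟩ := exists_primitive (analyticAt_contraction (hTa _ hxt) (hΨa _ hxt))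
    (by filter_upwards [e.open_target.mem_nhds hxt] with y hy using hsymm y hy)
  refine ⟨f ∘ e, ?_⟩
  filter_upwards [(e.continuousAt hx).eventually (hfA.and hf.eventually_analyticAt),
    e.open_source.mem_nhds hx] with m hm hms
  have hem := contMDiffAt_of_mem_maximalAtlas (I := model p d) (n := ω)
    (IsManifold.subset_maximalAtlas hea) hms
  refine ⟨hm.2.contDiffAt.contMDiffAt.comp m hem, fun (ξ : Model p k) v => ?_⟩
  have h1 : HasFDerivAt (fun y => f y ξ)
      ((contraction T (localAction c e) (c 1) (e m)).flip ξ) (e m) := by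
    simpa using hm.1.clm_apply (hasFDerivAt_const ξ (e m))
  have h2 := h1.hasMFDerivAt.comp m (hem.mdifferentiableAt (by simp)).hasMFDerivAt
  let w : Model p d := mfderiv (model p d) (model p d) e m v
  have h3 : contraction T (localAction c e) (c 1) (e m) w ξ =
      σ.inChart e (e m) ![fderiv ℚ_[p] (localAction c e) (c 1, e m) (ξ, 0), w] := by
    rw [contraction_apply, hT, alternatingToBilin_apply]
  have h4 : (mfderiv (model p d) 𝓘(ℚ_[p], ℚ_[p])
      (fun x : M => pairing (G := G) ((f ∘ e) x) ξ) m v : ℚ_[p]) =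
      contraction T (localAction c e) (c 1) (e m) w ξ :=
    congrArg (fun L : Model p d →L[ℚ_[p]] ℚ_[p] => L v) h2.mfderiv
  refine Eq.trans ?_ (h4.trans (h3.trans (DiffForm.inChart_apply_pair σ e _ _ _))).symm
  refine Eq.trans ?_ (DiffForm.apply_congr σ (e.left_inv hms).symm _)
  refine congrArg (fun w : Fin 2 → Model p d => σ m w) ?_
  refine congrArg₂ (fun a b : Model p d => ![a, b]) (generator_eq hea hms ξ) ?_
  exact (congrArg (fun L : Model p d →L[ℚ_[p]] Model p d => L v)
    ((mdifferentiable_of_mem_atlas (I := model p d) hea).symm_comp_deriv hms)).symm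

end MomentumMap

end

end PadicSymplectic

/-! ### Gluing over a clopen partition. -/

theorem theoremA (p : ℕ) [Fact p.Prime] (k n : ℕ)
    -- a `k`-dimensional `p`-adic analytic Lie group
    (G : Type*) [TopologicalSpace G] [ChartedSpace (PadicSymplectic.Model p k) G] [Group G]
    [LieGroup (PadicSymplectic.model p k) ω G]
    -- a paracompact (Hausdorff) `2n`-dimensional `p`-adic analytic manifold
    (M : Type*) [TopologicalSpace M] [T2Space M] [ParacompactSpace M]
    [ChartedSpace (PadicSymplectic.Model p (2 * n)) M]
    [IsManifold (PadicSymplectic.model p (2 * n)) ω M]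
    -- with a `p`-adic analytic symplectic form
    (σ : PadicSymplectic.DiffForm p (2 * n) 2 M) (hσ : PadicSymplectic.IsSymplecticForm σ)
    -- and a `p`-adic analytic symplectic action of `G`
    [MulAction G M]
    [ContMDiffSMul (PadicSymplectic.model p k) (PadicSymplectic.model p (2 * n)) ω G M]
    (hG : PadicSymplectic.IsSymplecticAction G σ) :
    PadicSymplectic.IsWeaklyHamiltonian k G σ := by
  have := ChartedSpace.locallyCompactSpace (PadicSymplectic.Model p (2 * n)) M
  choose μ hμ using PadicSymplectic.exists_local_momentumMap (k := k) G hσ hG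
  obtain ⟨c, hc, hcU⟩ := PadicSymplectic.exists_clopen_partition
    (PadicSymplectic.exists_isClopen_subset p (2 * n) (M := M)) _ hμ
  have hloc : ∀ m, ∀ᶠ x in nhds m, μ (c x) x = μ (c m) x := fun m => by
    filter_upwards [(IsLocallyConstant.iff_eventually_eq c).1 hc m] with x hx
    rw [hx]
  -- Near m the glued map coincides with the single local solution μ (c m), and both conditions are
  -- local.
  refine ⟨fun m => μ (c m) m, fun m => ?_, fun ξ m v => ?_⟩
  · exact (hcU m).1.congr_of_eventuallyEq (hloc m)
  · rw [(hcU m).2 ξ v]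
    have h : (fun x => PadicSymplectic.pairing (μ (c x) x) ξ) =ᶠ[nhds m]
        fun x => PadicSymplectic.pairing (μ (c m) x) ξ := by
      filter_upwards [hloc m] with x hx
      rw [hx]
    rw [h.mfderiv_eq]
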